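/- **Bin covering.** An input is a finite sequence $\sigma$ of items with sizes in $(0,1]$, which are to be placed into bins; a bin is covered if the items in it have total size at least $1$. Let $\mathrm{OPT}(\sigma)$ be the maximum number of bins that a packing of $\sigma$ can cover. A deterministic online algorithm $\mathbb{A}$ with advice irrevocably places the $i$-th item on the basis of the sizes of the first $i$ items and of the bits that it accesses on an infinite advice tape $\Phi\in\{0,1\}^{\mathbb{N}}$; let $\mathbb{A}(\sigma,\Phi)$ be the number of bins that it covers. For $s:\mathbb{N}\to\mathbb{N}$ and $c\in\mathbb{R}$, $\mathbb{A}$ is *$c$-competitive with advice complexity $s(n)$* if there is a constant $b$ such that for every $n$ and every input $\sigma$ of length at most $n$ there is a tape $\Phi$ with $\mathbb{A}(\sigma,\Phi)\ge c\cdot\mathrm{OPT}(\sigma)-b$ on which $\mathbb{A}$ accesses at most $s(n)$ bits while packing $\sigma$. The *competitive ratio* of $\mathbb{A}$ with advice complexity $s(n)$ is the supremum of all $c$ such that $\mathbb{A}$ is $c$-competitive with advice complexity $s(n)$. **Theorem.** For every fixed $\delta>0$ there is a constant $\kappa>0$, depending only on $\delta$, such that the following holds. If a deterministic online bin covering algorithm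 with advice complexity $s(n)$ has competitive ratio at least $15/16+\delta$, then $s(n)\ge\kappa n$ for all sufficiently large $n$. In other words, a competitive ratio of $15/16+\delta$ requires $\Omega(n)$ bits of advice. -/

import Mathlib

namespace BinCovering

/-- A valid input sequence: every item has a size in `(0, 1]`. -/
def IsInput (σ : List ℝ) : Prop := ∀ x ∈ σ, 0 < x ∧ x ≤ 1

/-- A packing of `σ`: the `i`-th item is put into the bin with label `p i`. -/
abbrev Packing (σ : List ℝ) : Type := Fin σ.length → ℕ

/-- The total size of the items of `σ` that the packing `p` puts into bin `j`. -/
noncomputable def level (σ : List ℝ) (p : Packing σ) (j : ℕ) : ℝ :=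
  ∑ i : Fin σ.length, if p i = j then σ.get i else 0

open Classical in
/-- The number of covered bins, i.e. used bins that receive items of total size at least `1`. -/
noncomputable def numCovered (σ : List ℝ) (p : Packing σ) : ℕ :=
  ((Finset.univ.image p).filter fun j => 1 ≤ level σ p j).card

/-- The number of bins covered by an optimal offline packing of `σ`. -/
noncomputable def opt (σ : List ℝ) : ℕ := ⨆ p : Packing σ, numCovered σ p

theorem numCovered_le_length (σ : List ℝ) (p : Packing σ) : numCovered σ p ≤ σ.length := by
  classical
  unfold numCovered
  refine (Finset.card_filter_le _ _).trans (Finset.card_image_le.trans ?_)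
  simp

/-- The supremum that defines `opt` is a maximum. -/
theorem opt_isGreatest (σ : List ℝ) : IsGreatest (Set.range (numCovered σ)) (opt σ) := by
  have hb : BddAbove (Set.range (numCovered σ)) :=
    ⟨σ.length, by rintro _ ⟨p, rfl⟩; exact numCovered_le_length σ p⟩
  exact ⟨Nat.sSup_mem (Set.range_nonempty _) hb, fun _ h => le_csSup hb h⟩

/-- An infinite advice tape. -/
abbrev Tape : Type := ℕ → Bool

/-- A deterministic online bin covering algorithm with an advice tape. Below, `l` is the list of
the sizes of the items revealed so far, and its last entry is the item that has to be packed now.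
The algorithm need not be computable, and it may access the tape adaptively and in any order. -/
structure OnlineAlgorithm where
  /-- The bin into which the last item of `l` is put. -/
  place : Tape → List ℝ → ℕ
  /-- The positions of the tape that are accessed up to the time this decision is made. -/
  accessed : Tape → List ℝ → Set ℕ
  /-- The decision depends only on the bits that have been accessed. -/
  place_congr : ∀ (Φ Φ' : Tape) (l : List ℝ),
    (∀ k ∈ accessed Φ l, Φ k = Φ' k) → place Φ' l = place Φ l
  /-- Which positions are accessed depends only on the bits that have been accessed. -/
  accessed_congr : ∀ (Φ Φ' : Tape) (l : List ℝ),
    (∀ k ∈ accessed Φ l, Φ k = Φ' k) → accessed Φ' l = accessed Φ l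

namespace OnlineAlgorithm

/-- The packing of `σ` that the algorithm produces with advice `Φ`. -/
def packing (A : OnlineAlgorithm) (Φ : Tape) (σ : List ℝ) : Packing σ :=
  fun i => A.place Φ (σ.take (i + 1))

/-- The number of bins of `σ` that the algorithm covers with advice `Φ`. -/
noncomputable def covered (A : OnlineAlgorithm) (Φ : Tape) (σ : List ℝ) : ℕ :=
  numCovered σ (A.packing Φ σ)

/-- All tape positions that the algorithm accesses while it packs `σ` with advice `Φ`. -/
def accessedOn (A : OnlineAlgorithm) (Φ : Tape) (σ : List ℝ) : Set ℕ :=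
  ⋃ i : Fin σ.length, A.accessed Φ (σ.take (i + 1))

/-- The algorithm is `c`-competitive with advice complexity `s`. -/
def IsCompetitive (A : OnlineAlgorithm) (s : ℕ → ℕ) (c : ℝ) : Prop :=
  ∃ b : ℝ, ∀ (n : ℕ) (σ : List ℝ), IsInput σ → σ.length ≤ n →
    ∃ Φ : Tape, c * (opt σ : ℝ) - b ≤ (A.covered Φ σ : ℝ) ∧
      (A.accessedOn Φ σ).encard ≤ (s n : ℕ∞)

/-- The competitive ratio of an algorithm with advice complexity `s`: the supremum of all `c` for
which it is `c`-competitive (in the extended reals, so `⊥` if there is no such `c`). -/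
noncomputable def competitiveRatio (A : OnlineAlgorithm) (s : ℕ → ℕ) : EReal :=
  sSup ((fun c : ℝ => (c : EReal)) '' {c : ℝ | A.IsCompetitive s c})

end OnlineAlgorithm

end BinCovering

/-!
Suppose that an algorithm reads at most `s` bits of advice. An input on which it does well with a
suitable tape is one on which it does well with a uniformly random tape with probability at least
`2⁻ˢ`. Hence, for any finite family of inputs, one fixed tape works for a fraction `2⁻ˢ` of the
family (`exists_tape_card_le`), and it suffices to find a family for which an algorithm without
advice does well on an exponentially small fraction only.

The inputs of the family have length `4m` and are indexed by the `m`-element subsets `x` of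
`{0, …, 2m - 1}`. They consist of `m` items of size `5/8`, then `2m` items of sizes in `(3/8, 1/2)`,
and finally `m` items of size `1 - θ`. The sizes of the second group are found by bisection, so that
the `i`-th one is above the threshold `θ` if `i ∈ x` (a large item) and below it otherwise (a small
item), while the size itself reveals nothing about which of the two is the case. Pairing the small
items with the first group and the large items with the third group covers `2m` bins
(`two_mul_le_opt_hardInput`).

An online packing guesses the type of each item of the second group: large if the item opens a new
bin, small if it does not. A weighting of the items, under which each covered bin has weight at
least `1` and each wrong guess reduces the total weight from `2m` by `1/8`, shows that `e` wrong
guesses leave at most `2m - e/8` covered bins (`numCovered_hardInput_le`). With `e ≈ m`, as for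
random guesses, this is the ratio `15/16`.

With a fixed tape, the set of wrong guesses determines `x` (`errors_injOn`). Therefore the number of
`x` with at most `(1 - η) m` wrong guesses is bounded by the number of subsets of
`{0, …, 2m - 1}` of that size, which is at most `4ᵐ exp (-η² m)` by a Chernoff bound
(`card_filter_card_le_chernoff`), whereas the family has at least `4ᵐ / (2m)` members. So
`2ˢ ≥ exp (η² m) / (2m)`.
-/

namespace BinCovering

open Finset

/-! ### Averaging over advice tapes -/

/-- If every `x ∈ H` has a good tape whose goodness is witnessed by at most `s` bits, then a
uniformly random tape is good for each `x` with probability at least `2⁻ˢ`, so that a single tape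
is good for a fraction `2⁻ˢ` of `H`. -/
theorem exists_tape_card_le {ι : Type*} (H : Finset ι) (P : ι → Tape → Prop) (s : ℕ)
    (h : ∀ x ∈ H, ∃ (Φ : Tape) (B : Finset ℕ), #B ≤ s ∧
      ∀ Ψ : Tape, (∀ k ∈ B, Φ k = Ψ k) → P x Ψ) :
    ∃ Ψ : Tape, ∃ G ⊆ H, (∀ x ∈ G, P x Ψ) ∧ #H ≤ 2 ^ s * #G := by
  classical
  choose! Φ B hB hP using h
  -- Only the bits in `K` matter; a subset `T` of `K` stands for the tape that is `true` on `T`.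
  set K : Finset ℕ := H.biUnion B with hK
  let tape : Finset ℕ → Tape := fun T k => decide (k ∈ T)
  have key : ∀ x ∈ H, 2 ^ #K ≤ 2 ^ s * #{T ∈ K.powerset | P x (tape T)} := by
    intro x hx
    have hBK : B x ⊆ K := subset_biUnion_of_mem B hx
    let lo := {k ∈ B x | Φ x k = true}
    let no := {k ∈ B x | ¬ Φ x k = true}
    have hlo : lo ⊆ B x := filter_subset _ _
    have hno : no ⊆ B x := filter_subset _ _
    have hdisj : Disjoint lo no := disjoint_filter_filter_not _ _ _
    have hloK : lo ⊆ K \ no := by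
      rw [subset_sdiff]; exact ⟨hlo.trans hBK, hdisj⟩
    have hsub : Icc lo (K \ no) ⊆ {T ∈ K.powerset | P x (tape T)} := by
      intro T hT
      rw [mem_Icc] at hT
      obtain ⟨h1, h2⟩ := hT
      rw [mem_filter, mem_powerset]
      refine ⟨h2.trans sdiff_subset, hP x hx _ fun k hk => ?_⟩
      by_cases hΦ : Φ x k = true
      · have : k ∈ T := h1 (mem_filter.2 ⟨hk, hΦ⟩)
        simp [tape, this, hΦ]
      · have : k ∉ T := fun hkT => (mem_sdiff.1 (h2 hkT)).2 (mem_filter.2 ⟨hk, hΦ⟩)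
        simp [tape, this, hΦ]
    have hcard : #lo + #no = #(B x) := card_filter_add_card_filter_not _
    have h3 := card_le_card hsub
    rw [card_Icc_finset hloK, card_sdiff_of_subset (hno.trans hBK)] at h3
    have h4 := hB x hx
    calc 2 ^ #K ≤ 2 ^ (s + (#K - #no - #lo)) := Nat.pow_le_pow_right (by norm_num) (by omega)
      _ = 2 ^ s * 2 ^ (#K - #no - #lo) := pow_add _ _ _
      _ ≤ _ := Nat.mul_le_mul_left _ h3
  by_contra! hcon
  have hlt : ∀ T ∈ K.powerset, 2 ^ s * #{x ∈ H | P x (tape T)} < #H := fun T _ =>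
    hcon (tape T) _ (filter_subset _ _) fun x hx => (mem_filter.1 hx).2
  have hsum : ∑ T ∈ K.powerset, 2 ^ s * #{x ∈ H | P x (tape T)} < ∑ _T ∈ K.powerset, #H :=
    sum_lt_sum_of_nonempty ⟨∅, by simp⟩ hlt
  have hsum' : ∑ _x ∈ H, 2 ^ #K ≤ ∑ x ∈ H, 2 ^ s * #{T ∈ K.powerset | P x (tape T)} :=
    sum_le_sum key
  rw [← mul_sum] at hsum hsum'
  have hswap : ∑ T ∈ K.powerset, #{x ∈ H | P x (tape T)}
      = ∑ x ∈ H, #{T ∈ K.powerset | P x (tape T)} := by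
    simp only [card_filter]
    exact sum_comm
  rw [hswap] at hsum
  simp only [sum_const, card_powerset, smul_eq_mul] at hsum hsum'
  linarith [mul_comm (#H) (2 ^ #K)]

/-! ### Counting small sets -/

/-- The Chernoff bound for the lower tail of the binomial distribution. -/
theorem card_filter_card_le_chernoff (m : ℕ) {η : ℝ} (hη : 0 ≤ η) :
    (#{S ∈ (range (2 * m)).powerset | ((#S : ℕ) : ℝ) ≤ (1 - η) * m} : ℝ)
      ≤ 4 ^ m * Real.exp (-(η ^ 2 * m)) := by
  have h1 : (#{S ∈ (range (2 * m)).powerset | ((#S : ℕ) : ℝ) ≤ (1 - η) * m} : ℝ)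
      ≤ ∑ S ∈ (range (2 * m)).powerset,
          Real.exp (2 * η * ((1 - η) * m)) * Real.exp (-(2 * η)) ^ #S := by
    rw [card_filter]
    push_cast
    refine sum_le_sum fun S _ => ?_
    split_ifs with hS
    · rw [← Real.exp_nat_mul, ← Real.exp_add]
      refine Real.one_le_exp ?_
      nlinarith [mul_le_mul_of_nonneg_left hS hη]
    · positivity
  have h2 : ∑ S ∈ (range (2 * m)).powerset, Real.exp (-(2 * η)) ^ #S
      = (Real.exp (-(2 * η)) + 1) ^ (2 * m) := by
    have := Finset.sum_pow_mul_eq_add_pow (Real.exp (-(2 * η))) 1 (range (2 * m))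
    simpa using this
  have h3 : Real.exp (-(2 * η)) + 1 = Real.exp (-η) * (2 * Real.cosh η) := by
    rw [Real.cosh_eq, show -(2 * η) = -η + -η by ring, Real.exp_add]
    have : Real.exp (-η) * Real.exp η = 1 := by rw [← Real.exp_add]; simp
    linarith
  refine h1.trans ?_
  rw [← mul_sum, h2, h3]
  calc Real.exp (2 * η * ((1 - η) * m)) * (Real.exp (-η) * (2 * Real.cosh η)) ^ (2 * m)
      ≤ Real.exp (2 * η * ((1 - η) * m)) *
          (Real.exp (-η) * (2 * Real.exp (η ^ 2 / 2))) ^ (2 * m) := by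
        have := Real.cosh_le_exp_half_sq η
        have := Real.cosh_pos η
        gcongr
    _ = 4 ^ m * Real.exp (-(η ^ 2 * m)) := by
        rw [show Real.exp (-η) * (2 * Real.exp (η ^ 2 / 2)) = 2 * Real.exp (-η + η ^ 2 / 2) by
          rw [Real.exp_add]; ring, mul_pow, pow_mul, ← Real.exp_nat_mul, mul_left_comm,
          ← Real.exp_add]
        congr 1
        · norm_num
        · congr 1; push_cast; ring

/-! ### The hard inputs -/

/-- The points of a bisection of the interval `(3/8, 1/2)`: the `k`-th point is above all later
ones if `k ∈ x` and below all later ones otherwise. -/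
noncomputable def bisect (x : Finset ℕ) : ℕ → ℝ
  | 0 => 7 / 16
  | k + 1 => bisect x k + (if k ∈ x then -1 else 1) / (32 * 2 ^ k)

theorem abs_bisect_sub_le (x : Finset ℕ) {i k : ℕ} (h : i ≤ k) :
    |bisect x k - bisect x i| ≤ 1 / (16 * 2 ^ i) - 1 / (16 * 2 ^ k) := by
  induction k, h using Nat.le_induction with
  | base => simp
  | succ k _ ih =>
    have e : (1 : ℝ) / (16 * 2 ^ (k + 1)) = 1 / (32 * 2 ^ k) := by rw [pow_succ]; ring_nf
    have e' : (1 : ℝ) / (16 * 2 ^ k) = 2 * (1 / (32 * 2 ^ k)) := by field_simp; norm_num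
    rw [abs_le] at ih ⊢
    simp only [bisect]
    rw [e]
    rw [e'] at ih
    have hpos : (0 : ℝ) < 1 / (32 * 2 ^ k) := by positivity
    split_ifs
    · rw [neg_div]; constructor <;> linarith [ih.1, ih.2]
    · constructor <;> linarith [ih.1, ih.2]

theorem bisect_mem (x : Finset ℕ) (k : ℕ) : 3 / 8 < bisect x k ∧ bisect x k < 1 / 2 := by
  have h := abs_le.1 (abs_bisect_sub_le x (Nat.zero_le k))
  have : (0 : ℝ) < 1 / (16 * 2 ^ k) := by positivity
  have e : bisect x 0 = 7 / 16 := rfl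
  rw [e, pow_zero] at h
  constructor <;> linarith [h.1, h.2]

theorem bisect_lt_of_mem {x : Finset ℕ} {i k : ℕ} (hi : i ∈ x) (h : i < k) :
    bisect x k < bisect x i := by
  have h1 := (abs_le.1 (abs_bisect_sub_le x (Nat.succ_le_of_lt h))).2
  have h2 : (0 : ℝ) < 1 / (16 * 2 ^ k) := by positivity
  have e : (1 : ℝ) / (16 * 2 ^ (i + 1)) = 1 / (32 * 2 ^ i) := by rw [pow_succ]; ring_nf
  simp only [Nat.succ_eq_add_one, bisect, if_pos hi, neg_div, e] at h1
  linarith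

theorem lt_bisect_of_notMem {x : Finset ℕ} {i k : ℕ} (hi : i ∉ x) (h : i < k) :
    bisect x i < bisect x k := by
  have h1 := (abs_le.1 (abs_bisect_sub_le x (Nat.succ_le_of_lt h))).1
  have h2 : (0 : ℝ) < 1 / (16 * 2 ^ k) := by positivity
  have e : (1 : ℝ) / (16 * 2 ^ (i + 1)) = 1 / (32 * 2 ^ i) := by rw [pow_succ]; ring_nf
  simp only [Nat.succ_eq_add_one, bisect, if_neg hi, e] at h1
  linarith

theorem bisect_congr {x y : Finset ℕ} {k : ℕ} (h : ∀ i < k, i ∈ x ↔ i ∈ y) :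
    bisect x k = bisect y k := by
  induction k with
  | zero => rfl
  | succ k ih =>
    simp only [bisect, ih fun i hi => h i (by omega), h k (by omega)]

/-- The sizes of the hard input for `x ⊆ {0, …, 2m - 1}`: `m` items of size `5/8`, followed by
`2m` items whose sizes are produced by bisection, the `i`-th of which is *large* if `i ∈ x` and
*small* otherwise, followed by `m` items that together with a large item, but not with a small
one, cover a bin. -/
noncomputable def item (m : ℕ) (x : Finset ℕ) (i : ℕ) : ℝ :=
  if i < m then 5 / 8 else if i < 3 * m then bisect x (i - m) else 1 - bisect x (2 * m)

/-- The hard input for the set `x` of large items. -/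
noncomputable def hardInput (m : ℕ) (x : Finset ℕ) : List ℝ := (List.range (4 * m)).map (item m x)

@[simp] theorem length_hardInput (m : ℕ) (x : Finset ℕ) : (hardInput m x).length = 4 * m := by
  simp [hardInput]

theorem item_bounds (m : ℕ) (x : Finset ℕ) (i : ℕ) : 3 / 8 < item m x i ∧ item m x i < 1 := by
  have h1 := bisect_mem x (i - m)
  have h2 := bisect_mem x (2 * m)
  unfold item
  split_ifs <;> constructor <;> linarith [h1.1, h1.2, h2.1, h2.2]

theorem isInput_hardInput (m : ℕ) (x : Finset ℕ) : IsInput (hardInput m x) := by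
  intro a ha
  obtain ⟨i, -, rfl⟩ := List.mem_map.1 ha
  have := item_bounds m x i
  constructor <;> linarith [this.1, this.2]

theorem item_congr {m : ℕ} {x y : Finset ℕ} {i j : ℕ} (hi : i < 2 * m)
    (h : ∀ k < i, k ∈ x ↔ k ∈ y) (hj : j ≤ m + i) : item m x j = item m y j := by
  unfold item
  split_ifs
  · rfl
  · exact bisect_congr fun k hk => h k (by omega)
  · omega

/-- The total size of the items in bin `j` if the `i`-th of the items of sizes `a 0, …, a (N - 1)`
is put into bin `q i`. -/
theorem level_map_range (a : ℕ → ℝ) (N : ℕ) (q : ℕ → ℕ) (j : ℕ) :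
    level ((List.range N).map a) (fun i => q i) j = ∑ i ∈ range N with q i = j, a i := by
  have hlen : ((List.range N).map a).length = N := by simp
  have : level ((List.range N).map a) (fun i => q i) j
      = ∑ i : Fin ((List.range N).map a).length, (fun k => if q k = j then a k else 0) i := by
    unfold level
    refine sum_congr rfl fun i _ => ?_
    simp
  rw [this, Fin.sum_univ_eq_sum_range (fun k => if q k = j then a k else 0), hlen, sum_filter]

/-! ### An offline packing of a hard input -/

theorem exists_surjOn_of_card {s : Finset ℕ} {m : ℕ} (h : #s = m) :
    ∃ r : ℕ → ℕ, ∀ j < m, ∃ i ∈ s, r i = j := by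
  classical
  let e := s.equivFinOfCardEq h
  refine ⟨fun i => if hi : i ∈ s then e ⟨i, hi⟩ else 0, fun j hj => ?_⟩
  refine ⟨e.symm ⟨j, hj⟩, (e.symm ⟨j, hj⟩).2, ?_⟩
  simp

/-- The packing that combines each large item with an item of the third group, and each small item
with an item of size `5/8`, covers `2m` bins. -/
theorem two_mul_le_opt_hardInput {m : ℕ} {x : Finset ℕ} (hx : x ⊆ range (2 * m)) (hm : #x = m) :
    2 * m ≤ opt (hardInput m x) := by
  classical
  obtain ⟨r, hr⟩ := exists_surjOn_of_card hm
  obtain ⟨t, ht⟩ := exists_surjOn_of_card (s := range (2 * m) \ x) (m := m)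
    (by rw [card_sdiff_of_subset hx, hm, card_range]; omega)
  let q : ℕ → ℕ := fun i =>
    if i < m then i else if i < 3 * m then (if i - m ∈ x then m + r (i - m) else t (i - m))
    else i - 2 * m
  have hpos := fun i => (item_bounds m x i).1
  have pair : ∀ j, ∀ i < 4 * m, ∀ k < 4 * m, i < k → q i = j → q k = j →
      1 ≤ item m x i + item m x k → j ∈ ((univ.image
        (fun i : Fin (hardInput m x).length => q i)).filter
          fun j => 1 ≤ level (hardInput m x) (fun i => q i) j) := by
    intro j i hi k hk hik hqi hqk h1
    rw [mem_filter, mem_image]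
    refine ⟨⟨⟨i, by simpa using hi⟩, mem_univ _, hqi⟩, ?_⟩
    rw [hardInput, level_map_range]
    refine h1.trans ?_
    rw [← sum_pair hik.ne]
    refine sum_le_sum_of_subset_of_nonneg ?_ fun l _ _ => by linarith [hpos l]
    intro l hl
    rcases mem_insert.1 hl with rfl | hl
    · simp [hi, hqi]
    · rw [mem_singleton.1 hl]; simp [hk, hqk]
  have hcov : 2 * m ≤ numCovered (hardInput m x) (fun i => q i) := by
    unfold numCovered
    rw [← card_range (2 * m)]
    refine card_le_card fun j hj => ?_
    rw [mem_range] at hj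
    by_cases hjm : j < m
    · obtain ⟨i, hi, hti⟩ := ht j hjm
      rw [mem_sdiff, mem_range] at hi
      refine pair j j (by omega) (m + i) (by omega) (by omega) (by simp [q, hjm]) ?_ ?_
      · simp only [q]
        rw [if_neg (by omega), if_pos (by omega), Nat.add_sub_cancel_left, if_neg hi.2, hti]
      · rw [item, if_pos hjm]
        linarith [hpos (m + i)]
    · obtain ⟨i, hi, hri⟩ := hr (j - m) (by omega)
      have hi' := mem_range.1 (hx hi)
      refine pair j (m + i) (by omega) (j + 2 * m) (by omega) (by omega) ?_ ?_ ?_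
      · simp only [q]
        rw [if_neg (by omega), if_pos (by omega), Nat.add_sub_cancel_left, if_pos hi]
        omega
      · simp only [q]
        rw [if_neg (by omega), if_neg (by omega)]
        omega
      · rw [item, item, if_neg (by omega), if_pos (by omega), if_neg (by omega),
          if_neg (by omega), Nat.add_sub_cancel_left]
        linarith [bisect_lt_of_mem hi hi']
  exact hcov.trans ((opt_isGreatest _).2 ⟨_, rfl⟩)

/-! ### Errors and the number of covered bins -/

/-- The `i`-th item is the first one of its bin in the packing `q`. -/
def IsFirst (q : ℕ → ℕ) (i : ℕ) : Prop := ∀ k < i, q k ≠ q i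

open Classical in
/-- The packing `q` is regarded as guessing that an item produced by bisection is large if it
opens a new bin with it. These are the positions of the wrong guesses. -/
noncomputable def errors (m : ℕ) (x : Finset ℕ) (q : ℕ → ℕ) : Finset ℕ :=
  {i ∈ range (2 * m) | ¬ (i ∈ x ↔ IsFirst q (m + i))}

open Classical in
/-- Weights of the items such that each covered bin has a total weight of at least `1`, while each
error decreases the total weight by `1/8`. -/
noncomputable def weight (m : ℕ) (x : Finset ℕ) (q : ℕ → ℕ) (i : ℕ) : ℝ :=
  if i < m then 5 / 8
  else if i < 3 * m then
    if IsFirst q i then if i - m ∈ x then 1 / 2 else 1 / 4 else 3 / 8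
  else 1 / 2

theorem sum_weight {m : ℕ} {x : Finset ℕ} (hx : x ⊆ range (2 * m)) (hm : #x = m) (q : ℕ → ℕ) :
    ∑ i ∈ range (4 * m), weight m x q i = 2 * m - (#(errors m x q) : ℝ) / 8 := by
  classical
  have h1 : ∑ i ∈ range m, weight m x q i = 5 / 8 * m := by
    rw [sum_congr rfl (g := fun _ => (5 / 8 : ℝ))
      fun i hi => by rw [weight, if_pos (mem_range.1 hi)]]
    simp [mul_comm]
  have h3 : ∑ i ∈ range m, weight m x q (m + 2 * m + i) = 1 / 2 * m := by
    rw [sum_congr rfl (g := fun _ => (1 / 2 : ℝ))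
      fun i hi => by rw [weight, if_neg (by omega), if_neg (by omega)]]
    simp [mul_comm]
  have h2 : ∑ i ∈ range (2 * m), weight m x q (m + i)
      = 7 / 8 * m - (#(errors m x q) : ℝ) / 8 := by
    have hmx : ∑ i ∈ range (2 * m), (if i ∈ x then (1 : ℝ) else 0) = m := by
      rw [sum_boole, filter_mem_eq_inter, inter_eq_right.2 hx, hm]
    have hsub : errors m x q ⊆ range (2 * m) := by unfold errors; exact filter_subset _ _
    have herr : ∑ i ∈ range (2 * m), (if i ∈ errors m x q then (1 : ℝ) else 0)
        = #(errors m x q) := by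
      rw [sum_boole, filter_mem_eq_inter, inter_eq_right.2 hsub]
    rw [sum_congr rfl (g := fun i => 3 / 8 + (if i ∈ x then (1 : ℝ) else 0) / 8
      - (if i ∈ errors m x q then (1 : ℝ) else 0) / 8)]
    · rw [sum_sub_distrib, sum_add_distrib, ← sum_div, ← sum_div, ← sum_div, hmx, herr,
        sum_const, card_range, nsmul_eq_mul]
      push_cast
      ring
    · intro i hi
      have := mem_range.1 hi
      rw [weight, if_neg (by omega), if_pos (by omega), Nat.add_sub_cancel_left]
      by_cases ha : i ∈ x <;> by_cases hb : IsFirst q (m + i) <;>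
        simp [errors, this, ha, hb] <;> norm_num
  rw [show 4 * m = m + 2 * m + m by ring, sum_range_add, sum_range_add, h1, h2, h3]
  ring

/-- A covered bin has at least two items. If it has exactly two, they are neither both produced by
bisection nor a small item followed by an item of the third group. -/
theorem one_le_sum_weight {m : ℕ} {x : Finset ℕ} {q : ℕ → ℕ} {j : ℕ}
    (h : 1 ≤ ∑ i ∈ range (4 * m) with q i = j, item m x i) :
    1 ≤ ∑ i ∈ range (4 * m) with q i = j, weight m x q i := by
  classical
  set F := {i ∈ range (4 * m) | q i = j} with hF
  have hmem : ∀ i ∈ F, i < 4 * m ∧ q i = j := fun i hi => by simpa [hF] using hi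
  have hne : F.Nonempty := by
    rw [nonempty_iff_ne_empty]
    intro h0
    rw [h0, sum_empty] at h
    linarith
  set i₀ := F.min' hne with hi₀
  have hi₀F : i₀ ∈ F := min'_mem _ _
  have hfirst : IsFirst q i₀ := by
    intro k hk hq
    have : k ∈ F := by
      rw [hF, mem_filter, mem_range]
      exact ⟨hk.trans (hmem _ hi₀F).1, hq.trans (hmem _ hi₀F).2⟩
    exact absurd (min'_le F k this) (not_le.2 hk)
  have hnot : ∀ i ∈ F.erase i₀, i₀ < i ∧ ¬ IsFirst q i := by
    intro i hi
    obtain ⟨h1, h2⟩ := mem_erase.1 hi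
    have hlt : i₀ < i := lt_of_le_of_ne (min'_le F i h2) (Ne.symm h1)
    exact ⟨hlt, fun hf => hf i₀ hlt ((hmem _ hi₀F).2.trans (hmem _ h2).2.symm)⟩
  have hw : ∀ i ∈ F.erase i₀, 3 / 8 ≤ weight m x q i := by
    intro i hi
    have := (hnot i hi).2
    unfold weight
    split_ifs <;> norm_num
  have hw₀ : 1 / 4 ≤ weight m x q i₀ := by
    unfold weight
    split_ifs <;> norm_num
  rw [← add_sum_erase _ _ hi₀F] at h ⊢
  have hsum := card_nsmul_le_sum _ _ _ hw
  rw [nsmul_eq_mul] at hsum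
  rcases Nat.lt_trichotomy (#(F.erase i₀)) 1 with hc | hc | hc
  · rw [Nat.lt_one_iff, card_eq_zero] at hc
    rw [hc, sum_empty] at h
    linarith [(item_bounds m x i₀).2]
  · obtain ⟨k, hk⟩ := card_eq_one.1 hc
    have hkF : k ∈ F.erase i₀ := by rw [hk]; exact mem_singleton_self k
    have hk1 := hnot k hkF
    rw [hk, sum_singleton] at h ⊢
    have b1 := bisect_mem x (i₀ - m)
    have b2 := bisect_mem x (k - m)
    unfold item at h
    by_cases c1 : i₀ < m
    · have := hw k hkF
      rw [weight, if_pos c1]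
      linarith
    · unfold weight
      rw [if_neg c1] at h ⊢
      rw [if_neg (show ¬ k < m by omega)] at h ⊢
      by_cases c2 : i₀ < 3 * m
      · rw [if_pos c2] at h ⊢
        by_cases c3 : k < 3 * m
        · rw [if_pos c3] at h
          linarith [b1.2, b2.2]
        · rw [if_neg c3] at h ⊢
          by_cases c4 : i₀ - m ∈ x
          · rw [if_pos hfirst, if_pos c4]
            norm_num
          · linarith [lt_bisect_of_notMem c4 (show i₀ - m < 2 * m by omega)]
      · rw [if_neg c2, if_neg (show ¬ k < 3 * m by omega)]
        norm_num
  · -- With at least three items, the weight is at least `1/4 + 2 * (3/8)`.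
    have : (2 : ℝ) ≤ #(F.erase i₀) := by exact_mod_cast hc
    linarith

/-- Each error costs at least an eighth of a bin. -/
theorem numCovered_hardInput_le {m : ℕ} {x : Finset ℕ} (hx : x ⊆ range (2 * m)) (hm : #x = m)
    (q : ℕ → ℕ) :
    (numCovered (hardInput m x) (fun i => q i) : ℝ) ≤ 2 * m - (#(errors m x q) : ℝ) / 8 := by
  classical
  rw [← sum_weight hx hm q]
  have hw : ∀ i, 0 ≤ weight m x q i := by
    intro i
    unfold weight
    split_ifs <;> norm_num
  let C : Finset ℕ := {j ∈ (univ.image fun i : Fin (hardInput m x).length => q i) |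
    1 ≤ level (hardInput m x) (fun i => q i) j}
  have hC : (numCovered (hardInput m x) (fun i => q i) : ℝ) = ∑ _j ∈ C, (1 : ℝ) := by
    rw [sum_const, nsmul_eq_mul, mul_one]
    simp only [numCovered, C]
  have hle : ∑ _j ∈ C, (1 : ℝ) ≤ ∑ j ∈ C, ∑ i ∈ range (4 * m) with q i = j, weight m x q i := by
    refine sum_le_sum fun j hj => one_le_sum_weight ?_
    rw [← level_map_range]
    exact (mem_filter.1 hj).2
  rw [hC]
  refine hle.trans ?_
  rw [sum_fiberwise_eq_sum_filter]
  exact sum_le_sum_of_subset_of_nonneg (filter_subset _ _) fun i _ _ => hw i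

/-! ### Online algorithms on hard inputs -/

/-- The bins chosen by `A` for the items of the hard input. -/
noncomputable def bins (A : OnlineAlgorithm) (Ψ : Tape) (m : ℕ) (x : Finset ℕ) (i : ℕ) : ℕ :=
  A.place Ψ ((List.range (i + 1)).map (item m x))

theorem packing_hardInput (A : OnlineAlgorithm) (Ψ : Tape) (m : ℕ) (x : Finset ℕ) :
    A.packing Ψ (hardInput m x) = fun i : Fin _ => bins A Ψ m x i := by
  funext i
  have hi : (i : ℕ) < 4 * m := by simpa using i.2
  simp only [OnlineAlgorithm.packing, bins, hardInput]
  rw [← List.map_take, List.take_range, min_eq_left (by omega)]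

theorem bins_congr (A : OnlineAlgorithm) (Ψ : Tape) {m : ℕ} {x y : Finset ℕ} {i j : ℕ}
    (hi : i < 2 * m) (h : ∀ k < i, k ∈ x ↔ k ∈ y) (hj : j ≤ m + i) :
    bins A Ψ m x j = bins A Ψ m y j := by
  unfold bins
  congr 1
  refine List.map_congr_left fun k hk => item_congr hi h ?_
  have := List.mem_range.1 hk
  omega

/-- With a fixed tape, a guess depends only on the types of the earlier items, and therefore the
set of wrong guesses determines all types. -/
theorem errors_injOn (A : OnlineAlgorithm) (Ψ : Tape) (m : ℕ) :
    Set.InjOn (fun x => errors m x (bins A Ψ m x)) {x | x ⊆ range (2 * m)} := by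
  classical
  intro x hx y hy hxy
  have key : ∀ i < 2 * m, i ∈ x ↔ i ∈ y := by
    intro i
    induction i using Nat.strong_induction_on with
    | _ i ih =>
      intro hi
      have hb : ∀ j ≤ m + i, bins A Ψ m x j = bins A Ψ m y j := fun j hj =>
        bins_congr A Ψ hi (fun k hk => ih k hk (hk.trans hi)) hj
      have hf : IsFirst (bins A Ψ m x) (m + i) ↔ IsFirst (bins A Ψ m y) (m + i) := by
        unfold IsFirst
        rw [hb _ le_rfl]
        exact forall₂_congr fun k hk => by rw [hb k hk.le]
      have := congrArg (i ∈ ·) hxy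
      simp only [errors, mem_filter, mem_range, hi, true_and, hf, eq_iff_iff] at this
      tauto
  ext i
  constructor
  · intro h; exact (key i (mem_range.1 (hx h))).1 h
  · intro h; exact (key i (mem_range.1 (hy h))).2 h

theorem covered_congr (A : OnlineAlgorithm) {Φ Ψ : Tape} {σ : List ℝ}
    (h : ∀ k ∈ A.accessedOn Φ σ, Φ k = Ψ k) : A.covered Ψ σ = A.covered Φ σ := by
  have : A.packing Ψ σ = A.packing Φ σ := by
    funext i
    exact A.place_congr _ _ _ fun k hk => h k (Set.mem_iUnion.2 ⟨i, hk⟩)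
  rw [OnlineAlgorithm.covered, this, OnlineAlgorithm.covered]

/-- If `s` bits of advice suffice to cover, in each hard input of length `4m`, all but
`(1 - η) m / 8` of the `2m` bins that can be covered, then `s` is at least linear in
`m`. -/
theorem exp_le_of_covered {A : OnlineAlgorithm} {m s : ℕ} (hm0 : 0 < m) {η : ℝ} (hη : 0 ≤ η)
    (h : ∀ x ⊆ range (2 * m), #x = m → ∃ Φ : Tape,
      2 * m - (1 - η) * m / 8 ≤ (A.covered Φ (hardInput m x) : ℝ) ∧
        (A.accessedOn Φ (hardInput m x)).encard ≤ (s : ℕ∞)) :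
    Real.exp (η ^ 2 * m) ≤ 2 * m * 2 ^ s := by
  classical
  obtain ⟨Ψ, G, hGH, hG, hcard⟩ := exists_tape_card_le (powersetCard m (range (2 * m)))
    (fun x Ψ => 2 * m - (1 - η) * m / 8 ≤ (A.covered Ψ (hardInput m x) : ℝ)) s (by
      intro x hx
      rw [mem_powersetCard] at hx
      obtain ⟨Φ, h1, h2⟩ := h x hx.1 hx.2
      have hfin : (A.accessedOn Φ (hardInput m x)).Finite := Set.finite_of_encard_le_coe h2
      refine ⟨Φ, hfin.toFinset, ?_, fun Ψ hΨ => ?_⟩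
      · rw [hfin.encard_eq_coe_toFinset_card] at h2
        exact_mod_cast h2
      · rw [covered_congr A (Φ := Φ) fun k hk => hΨ k (by simpa using hk)]
        exact h1)
  have hGle : (#G : ℝ) ≤ 4 ^ m * Real.exp (-(η ^ 2 * m)) := by
    refine le_trans ?_ (card_filter_card_le_chernoff m hη)
    norm_cast
    refine card_le_card_of_injOn (fun x => errors m x (bins A Ψ m x)) ?_
      ((errors_injOn A Ψ m).mono fun x hx => (mem_powersetCard.1 (hGH hx)).1)
    intro x hx
    obtain ⟨hx1, hx2⟩ := mem_powersetCard.1 (hGH hx)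
    have h1 := hG x hx
    have h2 := numCovered_hardInput_le hx1 hx2 (bins A Ψ m x)
    rw [OnlineAlgorithm.covered, packing_hardInput] at h1
    simp only [coe_filter, Set.mem_ofPred_eq, mem_powerset]
    exact ⟨by unfold errors; exact filter_subset _ _, by linarith⟩
  rw [card_powersetCard, card_range, ← Nat.centralBinom_eq_two_mul_choose] at hcard
  have hbin := Nat.four_pow_le_two_mul_self_mul_centralBinom m hm0
  have hmain : (4 : ℝ) ^ m ≤ 2 * m * (2 ^ s * (4 ^ m * Real.exp (-(η ^ 2 * m)))) := by
    calc (4 : ℝ) ^ m ≤ 2 * m * m.centralBinom := by exact_mod_cast hbin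
      _ ≤ 2 * m * (2 ^ s * #G) := by gcongr; exact_mod_cast hcard
      _ ≤ _ := by gcongr
  have h4 : (0 : ℝ) < 4 ^ m := by positivity
  have hexp := Real.exp_pos (η ^ 2 * m)
  rw [Real.exp_neg] at hmain
  have : (4 : ℝ) ^ m * Real.exp (η ^ 2 * m) ≤ 4 ^ m * (2 * m * 2 ^ s) := by
    calc (4 : ℝ) ^ m * Real.exp (η ^ 2 * m)
        ≤ 2 * m * (2 ^ s * (4 ^ m * (Real.exp (η ^ 2 * m))⁻¹)) * Real.exp (η ^ 2 * m) := by gcongr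
      _ = 4 ^ m * (2 * m * 2 ^ s) := by field_simp
  exact le_of_mul_le_mul_left this h4

end BinCovering

open BinCovering in
theorem mainTheorem4 (δ : ℝ) (hδ : 0 < δ) :
    ∃ κ : ℝ, 0 < κ ∧
      ∀ (A : BinCovering.OnlineAlgorithm) (s : ℕ → ℕ),
        ((15 / 16 + δ : ℝ) : EReal) ≤ A.competitiveRatio s →
          ∀ᶠ n : ℕ in Filter.atTop, κ * (n : ℝ) ≤ (s n : ℝ) := by
  -- A ratio above `15/16 + δ/2` allows at most about `(1 - 8δ) m` errors. Half of this margin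
  -- absorbs the additive constant, so that `η = 4δ`, and `16 δ² m ≤ s n + log (2m)` for `m = n / 4`.
  refine ⟨δ ^ 2, by positivity, fun A s hA => ?_⟩
  obtain ⟨c, hc, b, hb⟩ : ∃ c : ℝ, 15 / 16 + δ / 2 < c ∧ A.IsCompetitive s c := by
    have hlt : ((15 / 16 + δ / 2 : ℝ) : EReal) < A.competitiveRatio s :=
      lt_of_lt_of_le (EReal.coe_lt_coe_iff.2 (by linarith)) hA
    obtain ⟨_, ⟨c, hc, rfl⟩, hlt⟩ := lt_sSup_iff.1 hlt
    exact ⟨c, EReal.coe_lt_coe_iff.1 hlt, hc⟩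
  -- The hard inputs of length `4 * m ≤ n` are used for `m = n / 4`.
  have hquarter : Filter.Tendsto (fun n : ℕ => n / 4) Filter.atTop Filter.atTop :=
    Filter.tendsto_atTop.2 fun k => Filter.eventually_atTop.2 ⟨4 * k, fun n hn => by omega⟩
  have hcast : Filter.Tendsto (fun n : ℕ => ((n / 4 : ℕ) : ℝ)) Filter.atTop Filter.atTop :=
    tendsto_natCast_atTop_atTop.comp hquarter
  have hlog : ∀ᶠ n : ℕ in Filter.atTop,
      Real.log ((n / 4 : ℕ) : ℝ) + Real.log 2 ≤ 8 * δ ^ 2 * ((n / 4 : ℕ) : ℝ) := by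
    have h1 := hcast.eventually
      (Real.isLittleO_log_id_atTop.bound (show 0 < 4 * δ ^ 2 by positivity))
    filter_upwards [h1, hcast.eventually_ge_atTop (Real.log 2 / (4 * δ ^ 2))] with n h1 h2
    rw [div_le_iff₀ (by positivity)] at h2
    have h3 := le_trans (le_abs_self _) h1
    simp only [id, Real.norm_natCast] at h3
    linarith
  filter_upwards [hlog, hcast.eventually_ge_atTop (2 * b / δ), Filter.eventually_ge_atTop 4]
    with n hlog hbn hn
  set m := n / 4 with hm
  have hm0 : 0 < m := by omega
  have hm0' : (0 : ℝ) < m := by exact_mod_cast hm0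
  have hexp := exp_le_of_covered (A := A) (s := s n) hm0 (η := 4 * δ) (by positivity) (by
    intro x hx hxm
    obtain ⟨Φ, h1, h2⟩ := hb n (hardInput m x) (isInput_hardInput m x) (by simp; omega)
    refine ⟨Φ, le_trans ?_ h1, h2⟩
    have hopt : (2 * m : ℝ) ≤ opt (hardInput m x) := by
      exact_mod_cast two_mul_le_opt_hardInput hx hxm
    have h3 : (15 / 16 + δ / 2) * (2 * m) ≤ c * opt (hardInput m x) :=
      mul_le_mul hc.le hopt (by positivity) (by linarith)
    rw [div_le_iff₀ hδ] at hbn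
    linarith)
  have h5 := Real.log_le_log (Real.exp_pos _) hexp
  rw [Real.log_exp, Real.log_mul (by positivity) (by positivity),
    Real.log_mul (by positivity) (by positivity), Real.log_pow] at h5
  have h6 : (s n : ℝ) * Real.log 2 ≤ s n :=
    mul_le_of_le_one_right (by positivity) (by linarith [Real.log_two_lt_d9])
  have h7 : (n : ℝ) ≤ 8 * m := by
    have : n ≤ 8 * m := by omega
    exact_mod_cast this
  nlinarith [mul_le_mul_of_nonneg_left h7 (sq_nonneg δ)]
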